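/- Let $M=N=\mathbb Z^2$, paired by the dot product, and let $\Delta=\mathrm{conv}\{(-1,2),(2,-1),(-1,-1)\}\subset M_{\mathbb R}=\mathbb R^2$ be the moment polytope of $\mathbb P^2$ (with its anticanonical polarization). Let $h_0(0)=0$ and $h_0(m)=1$ for $m\in\Delta\cap M\setminus\{0\}$, and let $h:\Delta\cap M\to\mathbb Z$ be the height function $$h(m)=\max\{h_0(m),\ \langle(-1,4),m\rangle,\ \langle(1,5),m\rangle\}.$$ Put $\Delta_h^\vee=\{n\in N_{\mathbb R}:\langle m,n\rangle\le h(m)\text{ for all }m\in\Delta\cap M\}$, $A=\partial\Delta$, $B=\partial\Delta_h^\vee$, and let $A^\circ$, $B^\circ$ be the unions of the relative interiors of the facets of $\Delta$, $\Delta_h^\vee$. Every facet carries integral affine coordinates, namely those in which the integral vectors tangent to the facet become the standard lattice. Let $\mu_M$ and $\nu_N$ be the Lebesgue measures on $A^\circ$ and $B^\circ$ in these coordinates, extended by zero. For $m\in\Delta\cap M$ let $\tau_m=\{n\in\Delta_h^\vee:\langle m,n\rangle=h(m)\}$, and let $\mathrm{St}(m)$ be the union of all closed proper faces of $\Delta$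 that contain $m$. Let $\mathcal P(\Delta)$ be the set of convex functions $\Psi:N_{\mathbb R}\to\mathbb R$ with $\sup_{n}|\Psi(n)-\sup_{m\in\Delta\cap M}\langle m,n\rangle|<\infty$. Then, with $e_0=(1,0)$, $$\frac{\nu_N(\tau_{-e_0})}{\nu_N(B)}=\frac4{11}>\frac13=\frac{\mu_M(\mathrm{St}(-e_0))}{\mu_M(A)},$$ and there is no $\Psi\in\mathcal P(\Delta)$ that solves the Monge–Ampère equation $$\mathrm{MA}(\Psi|_{B^\circ})=c\,\nu_N,\qquad c=\frac{\mu_M(A)}{\nu_N(B)}.$$ Here $\Psi$ is said to solve this equation if, for every facet $\tau$ of $\Delta_h^\vee$, every integral affine coordinate $\beta$ on $\tau$ and every Borel set $E$ contained in the relative interior $\tau^\circ$ of $\tau$, the Lebesgue measure of $\partial(\Psi\circ\beta^{-1})(\beta(E))$ is $c\,\nu_N(E)$, where $\partial$ is the multivalued gradient (subdifferential) of the convex function $\Psi\circ\beta^{-1}$ on $\beta(\tau^\circ)$. -/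

import Mathlib

namespace TropicalMA

/-- The inclusion of the lattice `ℤ^k` in `ℝ^k`. Both `M` and `N` are `ℤ^k`, and the pairing
between `M_ℝ` and `N_ℝ` is the dot product. -/
def toReal {k : ℕ} (m : Fin k → ℤ) : Fin k → ℝ := fun i => (m i : ℝ)

/-- The lattice points `P ∩ ℤ^k`. -/
def latticePoints {k : ℕ} (P : Set (Fin k → ℝ)) : Set (Fin k → ℤ) := {m | toReal m ∈ P}

/-- The dual polytope `{n : ⟨m, n⟩ ≤ h m for all lattice points m of Δ}`. Only the values of `h`
at the lattice points of `Δ` matter. -/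
def dualPolytope {k : ℕ} (Δ : Set (Fin k → ℝ)) (h : (Fin k → ℤ) → ℤ) : Set (Fin k → ℝ) :=
  {n | ∀ m ∈ latticePoints Δ, toReal m ⬝ᵥ n ≤ (h m : ℝ)}

/-- The face `τ_m = {n ∈ dualPolytope Δ h : ⟨m, n⟩ = h m}` dual to the lattice point `m`. -/
def dualFace {k : ℕ} (Δ : Set (Fin k → ℝ)) (h : (Fin k → ℤ) → ℤ) (m : Fin k → ℤ) :
    Set (Fin k → ℝ) :=
  {n | n ∈ dualPolytope Δ h ∧ toReal m ⬝ᵥ n = (h m : ℝ)}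

/-- The closed star of `m` in the boundary of the polytope `P`: the union of all proper (closed)
faces of `P` that contain `m`. -/
def closedStar {k : ℕ} (P : Set (Fin k → ℝ)) (m : Fin k → ℝ) : Set (Fin k → ℝ) :=
  ⋃₀ {F | IsExposed ℝ P F ∧ F ≠ P ∧ m ∈ F}

/-- `F` is a facet, i.e. a `d`-dimensional face, of the full-dimensional polytope
`P` in `ℝ^(d+1)`. -/
def IsFacet {d : ℕ} (P F : Set (Fin (d + 1) → ℝ)) : Prop :=
  IsExposed ℝ P F ∧ F.Nonempty ∧ Module.finrank ℝ (vectorSpan ℝ F) = d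

/-- An (inverse) coordinate chart for the tropical affine structure on a facet `F`: an affine
parametrization of the affine span of `F` whose directions form a `ℤ`-basis of the lattice of all
integral vectors that are tangent to `F`. -/
structure LatticeChart {d : ℕ} (F : Set (Fin (d + 1) → ℝ)) where
  base : Fin (d + 1) → ℝ
  base_mem : base ∈ affineSpan ℝ F
  dir : Fin d → Fin (d + 1) → ℤ
  linearIndependent : LinearIndependent ℤ dir
  mem_span_iff : ∀ v : Fin (d + 1) → ℤ,
    v ∈ Submodule.span ℤ (Set.range dir) ↔ toReal v ∈ vectorSpan ℝ F

/-- The parametrization `y ↦ base + ∑ i, y i • dir i`; it is the inverse of a coordinate function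
on the facet. -/
def LatticeChart.param {d : ℕ} {F : Set (Fin (d + 1) → ℝ)} (c : LatticeChart F)
    (y : Fin d → ℝ) : Fin (d + 1) → ℝ :=
  c.base + ∑ i, y i • toReal (c.dir i)

open Classical in
/-- The integral Lebesgue measure on the relative interior of a facet `F`: Lebesgue measure in a
lattice chart. Two lattice charts of a facet differ by an element of `GL_d(ℤ)` and a translation,
so the measure does not depend on the chart. -/
noncomputable def facetMeasure {d : ℕ} (F : Set (Fin (d + 1) → ℝ)) :
    MeasureTheory.Measure (Fin (d + 1) → ℝ) :=
  if hF : Nonempty (LatticeChart F) then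
    (MeasureTheory.volume.restrict
      ((Classical.choice hF).param ⁻¹' intrinsicInterior ℝ F)).map (Classical.choice hF).param
  else 0

/-- The canonical integral Lebesgue measure on the union of the open facets of `P` (extended by
zero): `μ_M` for the polytope `Δ` and `ν_N` for its dual polytope. -/
noncomputable def boundaryMeasure {d : ℕ} (P : Set (Fin (d + 1) → ℝ)) :
    MeasureTheory.Measure (Fin (d + 1) → ℝ) :=
  MeasureTheory.Measure.sum fun F : {F : Set (Fin (d + 1) → ℝ) // IsFacet P F} =>
    facetMeasure F.1

/-- The boundary measure, scaled to total mass one. -/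
noncomputable def normalizedBoundaryMeasure {d : ℕ} (P : Set (Fin (d + 1) → ℝ)) :
    MeasureTheory.Measure (Fin (d + 1) → ℝ) :=
  (boundaryMeasure P (frontier P))⁻¹ • boundaryMeasure P

/-- The class `𝒫(Δ)` of convex functions on `N_ℝ` at bounded distance from the function
`n ↦ sup {⟨m, n⟩ : m ∈ Δ ∩ M}`. -/
def IsPotential {k : ℕ} (Δ : Set (Fin k → ℝ)) (Ψ : (Fin k → ℝ) → ℝ) : Prop :=
  ConvexOn ℝ Set.univ Ψ ∧
    ∃ C : ℝ, ∀ n, |Ψ n - ⨆ m : latticePoints Δ, toReal m.1 ⬝ᵥ n| ≤ C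

/-- The multivalued gradient at `y` of the function `f` on `U`. -/
def subgradient {d : ℕ} (U : Set (Fin d → ℝ)) (f : (Fin d → ℝ) → ℝ) (y : Fin d → ℝ) :
    Set (Fin d → ℝ) :=
  {p | ∀ y' ∈ U, f y + p ⬝ᵥ (y' - y) ≤ f y'}

/-- The Monge-Ampère mass of a subset `E` of the open facet with closure `F`, in the chart `c`:
the Lebesgue measure of the image of `E` under the multivalued gradient of `Ψ` restricted to the
open facet. -/
noncomputable def mongeAmpere {d : ℕ} {F : Set (Fin (d + 1) → ℝ)} (c : LatticeChart F)
    (Ψ : (Fin (d + 1) → ℝ) → ℝ) (E : Set (Fin (d + 1) → ℝ)) : ENNReal :=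
  MeasureTheory.volume
    (⋃ y ∈ c.param ⁻¹' E, subgradient (c.param ⁻¹' intrinsicInterior ℝ F) (Ψ ∘ c.param) y)

/-- `Ψ` solves the equation `MA(Ψ|_{B°}) = ν` on the union `B°` of the open facets of `P`. -/
def SolvesMongeAmpere {d : ℕ} (P : Set (Fin (d + 1) → ℝ)) (Ψ : (Fin (d + 1) → ℝ) → ℝ)
    (ν : MeasureTheory.Measure (Fin (d + 1) → ℝ)) : Prop :=
  ∀ τ, IsFacet P τ → ∀ c : LatticeChart τ, ∀ E ⊆ intrinsicInterior ℝ τ, MeasurableSet E →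
    mongeAmpere c Ψ E = ν E

/-- The right-hand side `c ν_N`, `c = μ_M(A) / ν_N(B)`: the measure `ν_N` scaled to have the same
total mass as `μ_M`. -/
noncomputable def canonicalTarget {d : ℕ} (Δ : Set (Fin (d + 1) → ℝ))
    (h : (Fin (d + 1) → ℤ) → ℤ) : MeasureTheory.Measure (Fin (d + 1) → ℝ) :=
  (boundaryMeasure Δ (frontier Δ) /
      boundaryMeasure (dualPolytope Δ h) (frontier (dualPolytope Δ h))) •
    boundaryMeasure (dualPolytope Δ h)

/-- The moment polytope of the anticanonically polarized projective plane. -/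
def momentP2 : Set (Fin 2 → ℝ) :=
  convexHull ℝ {toReal ![-1, 2], toReal ![2, -1], toReal ![-1, -1]}

/-- The trivial height function. -/
def trivialHeight {k : ℕ} (m : Fin k → ℤ) : ℤ := if m = 0 then 0 else 1

/-- The height function `h(m) = max {h₀(m), ⟨(-1,4), m⟩, ⟨(1,5), m⟩}`. -/
def heightP2 (m : Fin 2 → ℤ) : ℤ :=
  max (trivialHeight m) (max (![-1, 4] ⬝ᵥ m) (![1, 5] ⬝ᵥ m))

end TropicalMA

/-! The obstruction is one-dimensional and sits on a single facet. The dual polytope is the pentagon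
with vertices (-1,0), (-1,4), (1,5), (1,1), (0,-1); its edges have lattice lengths 4, 1, 4, 1, 1, of
sum 11. The boundary of Δ has three edges of length 3, of sum 9, so c = 9/11. The facet dual to
(-1,0) is the edge of length 4 on the line x₀ = -1, and the equation asks for mass 4 · 9/11 = 36/11
there.

A potential stays at bounded distance from z ↦ sup (-m₀ + m₁z) on that line, and -1 ≤ m₁ ≤ 2 on Δ.
By convexity a subgradient on the open facet is a subgradient on the whole line
(`subgradient_global`), so comparing growth at ±∞ puts it in [-1, 2]
(`IsPotential.subgradient_mem_Icc`). The available mass is thus at most 3 < 36/11. This is the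
inequality 4/11 > 1/3 multiplied by 9, since the star of (-1,0) is an edge of length 3.

The remaining work identifies all facets and their measures. `IsFacet.exists_eq` shows that each
facet of a polygon comes from one of its inequalities, and `LatticeChart.volume_preimage` that every
lattice chart gives an edge its lattice length. -/

namespace TropicalMA

open MeasureTheory

/-! ### Relative interior and direction of a segment -/

section Segment

/-- Intrinsic interiors commute with affine isometries. Parametrizing by arc length reduces the
claim to a nondegenerate interval in ℝ, whose affine span is all of ℝ, so that its intrinsic
interior is its interior. -/
theorem intrinsicInterior_segment {E : Type*} [NormedAddCommGroup E] [NormedSpace ℝ E] {p q : E}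
    (hpq : p ≠ q) : intrinsicInterior ℝ (segment ℝ p q) = openSegment ℝ p q := by
  have hw : q - p ≠ 0 := sub_ne_zero.2 hpq.symm
  have hr : 0 < ‖q - p‖ := norm_pos_iff.2 hw
  let φ : ℝ →ᵃⁱ[ℝ] E := (AffineIsometryEquiv.vaddConst ℝ p).toAffineIsometry.comp
    (LinearIsometry.toSpanSingleton ℝ E (v := ‖q - p‖⁻¹ • (q - p))
      (by rw [norm_smul, norm_inv, norm_norm, inv_mul_cancel₀ hr.ne'])).toAffineIsometry
  have hφ : ∀ t, φ t = p + (t / ‖q - p‖) • (q - p) := fun t => by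
    simp [φ, smul_smul, div_eq_mul_inv, add_comm]
  have h1 : segment ℝ p q = φ '' Set.Icc 0 ‖q - p‖ := by
    rw [segment_eq_image']
    ext x
    constructor
    · rintro ⟨t, ht, rfl⟩
      refine ⟨t * ‖q - p‖, ⟨mul_nonneg ht.1 hr.le, by nlinarith [ht.2]⟩, ?_⟩
      rw [hφ, mul_div_cancel_right₀ _ hr.ne']
    · rintro ⟨t, ht, rfl⟩
      exact ⟨t / ‖q - p‖, ⟨div_nonneg ht.1 hr.le, (div_le_one hr).2 ht.2⟩, (hφ t).symm⟩
  have h2 : openSegment ℝ p q = φ '' Set.Ioo 0 ‖q - p‖ := by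
    rw [openSegment_eq_image']
    ext x
    constructor
    · rintro ⟨t, ht, rfl⟩
      refine ⟨t * ‖q - p‖, ⟨mul_pos ht.1 hr, by nlinarith [ht.2]⟩, ?_⟩
      rw [hφ, mul_div_cancel_right₀ _ hr.ne']
    · rintro ⟨t, ht, rfl⟩
      exact ⟨t / ‖q - p‖, ⟨div_pos ht.1 hr, (div_lt_one hr).2 ht.2⟩, (hφ t).symm⟩
  have h3 : affineSpan ℝ (Set.Icc 0 ‖q - p‖) = ⊤ := by
    refine affineSpan_eq_top_of_nonempty_interior ?_
    rw [(convex_Icc 0 ‖q - p‖).convexHull_eq, interior_Icc]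
    exact Set.nonempty_Ioo.2 hr
  rw [h1, h2, AffineIsometry.intrinsicInterior_image]
  congr 1
  refine Set.Subset.antisymm ?_ ?_
  · rintro x hx
    rw [← interior_Icc]
    rw [mem_intrinsicInterior] at hx
    obtain ⟨y, hy, rfl⟩ := hx
    rw [mem_interior_iff_mem_nhds] at hy ⊢
    have ho : IsOpen (affineSpan ℝ (Set.Icc 0 ‖q - p‖) : Set ℝ) := by
      rw [h3]
      exact isOpen_univ
    have := ho.isOpenMap_subtype_val.image_mem_nhds hy
    exact Filter.mem_of_superset this (Set.image_preimage_subset _ _)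
  · rw [← interior_Icc]
    exact interior_subset_intrinsicInterior

theorem mem_openSegment_add_smul {E : Type*} [AddCommGroup E] [Module ℝ E] {p v : E} {L : ℝ}
    (hL : 0 < L) {x : E} :
    x ∈ openSegment ℝ p (p + L • v) ↔ ∃ t : ℝ, 0 < t ∧ t < L ∧ x = p + t • v := by
  rw [openSegment_eq_image']
  constructor
  · rintro ⟨t, ht, rfl⟩
    refine ⟨t * L, mul_pos ht.1 hL, by nlinarith [ht.2], ?_⟩
    simp [smul_smul]
  · rintro ⟨t, h0, h1, rfl⟩
    refine ⟨t / L, ⟨div_pos h0 hL, (div_lt_one hL).2 h1⟩, ?_⟩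
    simp [smul_smul, div_mul_cancel₀ _ hL.ne']

theorem mem_vectorSpan_segment_add_smul {E : Type*} [NormedAddCommGroup E] [NormedSpace ℝ E]
    {p v : E} {L : ℝ} (hL : 0 < L) {x : E} :
    x ∈ vectorSpan ℝ (segment ℝ p (p + L • v)) ↔ ∃ t : ℝ, x = t • v := by
  rw [vectorSpan_segment, Submodule.mem_span_singleton]
  constructor
  · rintro ⟨t, rfl⟩
    exact ⟨t * L, by simp [smul_smul]⟩
  · rintro ⟨t, rfl⟩
    exact ⟨t / L, by simp [smul_smul, div_mul_cancel₀ _ hL.ne']⟩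

end Segment

/-! ### Lattice edges, their charts and their integral length -/

theorem toReal_injective {k : ℕ} : Function.Injective (toReal : (Fin k → ℤ) → Fin k → ℝ) := by
  intro a b h
  funext i
  exact Int.cast_injective (congrFun h i)

theorem toReal_smul {k : ℕ} (a : ℤ) (m : Fin k → ℤ) : toReal (a • m) = (a : ℝ) • toReal m := by
  funext i
  simp [toReal]

/-- The segment of lattice length `L` that starts at `p` and points in the integral direction
`v`. -/
def edge (p : Fin 2 → ℝ) (v : Fin 2 → ℤ) (L : ℝ) : Set (Fin 2 → ℝ) :=
  segment ℝ p (p + L • toReal v)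

section Edge

variable {p : Fin 2 → ℝ} {v : Fin 2 → ℤ} {L : ℝ}

theorem mem_edge (hL : 0 < L) {x : Fin 2 → ℝ} :
    x ∈ edge p v L ↔ ∃ t : ℝ, 0 ≤ t ∧ t ≤ L ∧ x = p + t • toReal v := by
  rw [edge, segment_eq_image']
  constructor
  · rintro ⟨t, ht, rfl⟩
    refine ⟨t * L, mul_nonneg ht.1 hL.le, by nlinarith [ht.2], ?_⟩
    simp [smul_smul]
  · rintro ⟨t, h0, h1, rfl⟩
    refine ⟨t / L, ⟨div_nonneg h0 hL.le, (div_le_one hL).2 h1⟩, ?_⟩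
    simp [smul_smul, div_mul_cancel₀ _ hL.ne']

theorem toReal_ne_zero (hv : IsCoprime (v 0) (v 1)) : toReal v ≠ 0 := by
  intro h
  have h0 : v = 0 := toReal_injective (by rw [h]; funext i; simp [toReal])
  rw [h0] at hv
  exact not_isCoprime_zero_zero hv

theorem mem_intrinsicInterior_edge (hv : IsCoprime (v 0) (v 1)) (hL : 0 < L) {x : Fin 2 → ℝ} :
    x ∈ intrinsicInterior ℝ (edge p v L) ↔ ∃ t : ℝ, 0 < t ∧ t < L ∧ x = p + t • toReal v := by
  rw [edge, intrinsicInterior_segment, mem_openSegment_add_smul hL]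
  intro h
  rw [left_eq_add, smul_eq_zero] at h
  exact h.elim hL.ne' (toReal_ne_zero hv)

theorem finrank_vectorSpan_edge (hv : IsCoprime (v 0) (v 1)) (hL : 0 < L) :
    Module.finrank ℝ (vectorSpan ℝ (edge p v L)) = 1 := by
  rw [edge, vectorSpan_segment]
  refine finrank_span_singleton ?_
  simp [hL.ne', toReal_ne_zero hv]

/-- Primitivity of `v` enters through Bézout: if `w = t • v` and `a * v 0 + b * v 1 = 1`, then `t =
a * w 0 + b * w 1` is an integer. -/
theorem toReal_mem_vectorSpan_edge (hv : IsCoprime (v 0) (v 1)) (hL : 0 < L) (w : Fin 2 → ℤ) :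
    toReal w ∈ vectorSpan ℝ (edge p v L) ↔ ∃ a : ℤ, w = a • v := by
  rw [edge, mem_vectorSpan_segment_add_smul hL]
  constructor
  · rintro ⟨t, ht⟩
    obtain ⟨a, b, hab⟩ := hv
    refine ⟨a * w 0 + b * w 1, toReal_injective ?_⟩
    have h0 : (w 0 : ℝ) = t * v 0 := congrFun ht 0
    have h1 : (w 1 : ℝ) = t * v 1 := congrFun ht 1
    have habR : (a * v 0 + b * v 1 : ℝ) = 1 := by exact_mod_cast hab
    have : ((a * w 0 + b * w 1 : ℤ) : ℝ) = t := by
      push_cast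
      rw [h0, h1]
      linear_combination t * habR
    rw [toReal_smul, this, ht]
  · rintro ⟨a, rfl⟩
    exact ⟨a, toReal_smul a v⟩

/-- The chart of an edge whose parameter is the lattice distance from the starting point. -/
noncomputable def edgeChart (p : Fin 2 → ℝ) (hv : IsCoprime (v 0) (v 1)) (hL : 0 < L) :
    LatticeChart (d := 1) (edge p v L) where
  base := p
  base_mem := subset_affineSpan ℝ _ (left_mem_segment ℝ _ _)
  dir := fun _ => v
  linearIndependent := by
    rw [linearIndependent_unique_iff]
    rintro rfl
    exact not_isCoprime_zero_zero hv
  mem_span_iff := fun w => by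
    rw [toReal_mem_vectorSpan_edge hv hL, Set.range_const, Submodule.mem_span_singleton]
    exact exists_congr fun a => eq_comm

/-- The direction of the chart and `v` generate the same rank-one lattice, so they differ by a unit
of ℤ. -/
theorem LatticeChart.dir_eq_or_neg (hv : IsCoprime (v 0) (v 1)) (hL : 0 < L)
    (c : LatticeChart (d := 1) (edge p v L)) : c.dir 0 = v ∨ c.dir 0 = -v := by
  have hr : Set.range c.dir = {c.dir 0} := by
    ext x
    simp [eq_comm]
  have hs : ∀ w, (∃ a : ℤ, a • c.dir 0 = w) ↔ ∃ a : ℤ, w = a • v := fun w => by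
    rw [← toReal_mem_vectorSpan_edge (p := p) hv hL, ← c.mem_span_iff, hr,
      Submodule.mem_span_singleton]
  obtain ⟨a, ha⟩ := (hs (c.dir 0)).1 ⟨1, one_smul _ _⟩
  obtain ⟨b, hb⟩ := (hs v).2 ⟨1, (one_smul _ _).symm⟩
  have hv0 : v ≠ 0 := by
    rintro rfl
    exact not_isCoprime_zero_zero hv
  have hab : (b * a) • v = (1 : ℤ) • v := by rw [mul_smul, ← ha, hb, one_smul]
  have hab' : b * a = 1 := smul_left_injective ℤ hv0 hab
  rcases Int.isUnit_iff.1 (IsUnit.of_mul_eq_one_right b hab') with h | h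
  · left
    rw [ha, h, one_smul]
  · right
    rw [ha, h, neg_smul, one_smul]

theorem LatticeChart.param_one {F : Set (Fin 2 → ℝ)} (c : LatticeChart (d := 1) F)
    (y : Fin 1 → ℝ) : c.param y = c.base + y 0 • toReal (c.dir 0) := by
  simp [LatticeChart.param]

theorem LatticeChart.measurable_param {d : ℕ} {F : Set (Fin (d + 1) → ℝ)} (c : LatticeChart F) :
    Measurable c.param := by
  have : Continuous c.param := by
    unfold LatticeChart.param
    fun_prop
  exact this.measurable

theorem volume_setOf_Ioo (a b : ℝ) :
    volume {y : Fin 1 → ℝ | a < y 0 ∧ y 0 < b} = ENNReal.ofReal (b - a) := by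
  have : {y : Fin 1 → ℝ | a < y 0 ∧ y 0 < b} = Set.pi Set.univ fun _ => Set.Ioo a b := by
    ext y
    simp
  rw [this, Real.volume_pi_Ioo]
  simp

/-- `facetMeasure` uses a chart obtained by choice, so the length has to be computed in every chart.
A chart differs from the standard one by a translation `s` and a sign, neither of which changes the
length. -/
theorem LatticeChart.volume_preimage (hv : IsCoprime (v 0) (v 1)) (hL : 0 < L)
    (c : LatticeChart (d := 1) (edge p v L)) :
    volume (c.param ⁻¹' intrinsicInterior ℝ (edge p v L)) = ENNReal.ofReal L := by
  have hv0 : toReal v ≠ 0 := toReal_ne_zero hv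
  obtain ⟨s, hs⟩ : ∃ s : ℝ, c.base = p + s • toReal v := by
    have h1 := AffineSubspace.vsub_mem_direction c.base_mem
      (subset_affineSpan ℝ _ (left_mem_segment ℝ p (p + L • toReal v)))
    rw [direction_affineSpan] at h1
    obtain ⟨s, hs⟩ := (mem_vectorSpan_segment_add_smul hL).1 h1
    exact ⟨s, by rw [← hs]; simp⟩
  have key : ∀ r : ℝ, p + r • toReal v ∈ intrinsicInterior ℝ (edge p v L) ↔ 0 < r ∧ r < L := by
    intro r
    rw [mem_intrinsicInterior_edge hv hL]
    constructor
    · rintro ⟨t, h0, h1, h⟩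
      rw [smul_left_injective ℝ hv0 (add_left_cancel h)]
      exact ⟨h0, h1⟩
    · exact fun h => ⟨r, h.1, h.2, rfl⟩
  rcases c.dir_eq_or_neg hv hL with h | h
  · have : c.param ⁻¹' intrinsicInterior ℝ (edge p v L) =
        {y : Fin 1 → ℝ | -s < y 0 ∧ y 0 < L - s} := by
      ext y
      rw [Set.mem_preimage, c.param_one, hs, h, add_assoc, ← add_smul, key]
      constructor <;> rintro ⟨h1, h2⟩ <;> constructor <;> linarith
    rw [this, volume_setOf_Ioo]
    ring_nf
  · have : c.param ⁻¹' intrinsicInterior ℝ (edge p v L) =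
        {y : Fin 1 → ℝ | s - L < y 0 ∧ y 0 < s} := by
      ext y
      have h3 : toReal (-v) = -toReal v := by
        funext i
        simp [toReal]
      rw [Set.mem_preimage, c.param_one, hs, h, h3, smul_neg, ← neg_smul, add_assoc, ← add_smul,
        key]
      constructor <;> rintro ⟨h1, h2⟩ <;> constructor <;> linarith
    rw [this, volume_setOf_Ioo]
    ring_nf

theorem facetMeasure_edge_of_subset (hv : IsCoprime (v 0) (v 1)) (hL : 0 < L)
    {S : Set (Fin 2 → ℝ)} (hS : MeasurableSet S) (h : intrinsicInterior ℝ (edge p v L) ⊆ S) :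
    facetMeasure (d := 1) (edge p v L) S = ENNReal.ofReal L := by
  rw [facetMeasure, dif_pos ⟨edgeChart p hv hL⟩,
    Measure.map_apply (LatticeChart.measurable_param _) hS,
    Measure.restrict_apply (LatticeChart.measurable_param _ hS),
    Set.inter_eq_right.2 (Set.preimage_mono h), LatticeChart.volume_preimage hv hL]

theorem facetMeasure_of_disjoint {d : ℕ} {F S : Set (Fin (d + 1) → ℝ)}
    (hS : MeasurableSet S) (h : Disjoint S (intrinsicInterior ℝ F)) :
    facetMeasure F S = 0 := by
  rw [facetMeasure]
  split_ifs with hF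
  · rw [Measure.map_apply (LatticeChart.measurable_param _) hS,
      Measure.restrict_apply (LatticeChart.measurable_param _ hS), ← Set.preimage_inter,
      h.inter_eq, Set.preimage_empty, measure_empty]
  · rfl

theorem boundaryMeasure_apply {d k : ℕ} {P : Set (Fin (d + 1) → ℝ)}
    {F : Fin k → Set (Fin (d + 1) → ℝ)} (hinj : Function.Injective F)
    (hF : ∀ G, IsFacet P G ↔ ∃ i, F i = G) {S : Set (Fin (d + 1) → ℝ)} (hS : MeasurableSet S) :
    boundaryMeasure P S = ∑ i, facetMeasure (F i) S := by
  rw [boundaryMeasure, Measure.sum_apply _ hS]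
  let e : Fin k ≃ {G // IsFacet P G} := Equiv.ofBijective
    (fun i => ⟨F i, (hF _).2 ⟨i, rfl⟩⟩)
    ⟨fun i j h => hinj (congrArg Subtype.val h), fun ⟨G, hG⟩ => by
      obtain ⟨i, hi⟩ := (hF G).1 hG
      exact ⟨i, Subtype.ext hi⟩⟩
  rw [← e.tsum_eq, tsum_fintype]
  rfl

end Edge

/-! ### Facets of a polygon given by inequalities -/

section Polygon

variable {k : ℕ} {P : Set (Fin 2 → ℝ)} {u : Fin k → Fin 2 → ℝ} {b : Fin k → ℝ}

theorem strongDual_apply (l : StrongDual ℝ (Fin 2 → ℝ)) (x : Fin 2 → ℝ) :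
    l x = l ![1, 0] * x 0 + l ![0, 1] * x 1 := by
  have : x = x 0 • ![1, 0] + x 1 • ![0, 1] := by
    funext i
    fin_cases i <;> simp
  conv_lhs => rw [this]
  rw [map_add, map_smul, map_smul, smul_eq_mul, smul_eq_mul]
  ring

theorem isExposed_setOf_dotProduct_eq {u : Fin 2 → ℝ} {b : ℝ} (h : ∀ x ∈ P, u ⬝ᵥ x ≤ b) :
    IsExposed ℝ P {x ∈ P | u ⬝ᵥ x = b} := by
  rintro ⟨x₀, hx₀, hb⟩
  refine ⟨LinearMap.toContinuousLinearMap (dotProductBilin ℝ ℝ u), ?_⟩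
  ext x
  have hl : ∀ y, LinearMap.toContinuousLinearMap (dotProductBilin ℝ ℝ u) y = u ⬝ᵥ y := fun _ => rfl
  simp only [Set.mem_ofPred_eq, hl]
  constructor
  · rintro ⟨hx, hxb⟩
    exact ⟨hx, fun y hy => hxb ▸ h y hy⟩
  · rintro ⟨hx, hm⟩
    exact ⟨hx, le_antisymm (h x hx) (hb ▸ hm x₀ hx₀)⟩

/-- A facet of a polygon that is given by inequalities is the locus where one of them is an
equality. -/
theorem IsFacet.exists_eq (hP : P = {x | ∀ i, u i ⬝ᵥ x ≤ b i}) {o : Fin 2 → ℝ}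
    (ho : ∀ i, u i ⬝ᵥ o < b i) {F : Set (Fin 2 → ℝ)} (hF : IsFacet (d := 1) P F) :
    ∃ i, {x ∈ P | u i ⬝ᵥ x = b i} = F := by
  obtain ⟨hexp, hne, hrank⟩ := hF
  obtain ⟨l, hl⟩ := hexp hne
  have hnhds : ∀ x, (∀ i, u i ⬝ᵥ x < b i) → P ∈ nhds x := by
    intro x hx
    have hopen : IsOpen {y : Fin 2 → ℝ | ∀ i, u i ⬝ᵥ y < b i} := by
      rw [Set.ofPred_forall]
      refine isOpen_iInter_of_finite fun i => isOpen_lt ?_ continuous_const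
      show Continuous fun y : Fin 2 → ℝ => ∑ j, u i j * y j
      fun_prop
    refine Filter.mem_of_superset (hopen.mem_nhds hx) fun y hy => ?_
    rw [hP]
    exact fun i => (hy i).le
  -- The zero functional would expose all of `P`, which has interior points and hence dimension 2
  -- instead of 1.
  have hl0 : l ≠ 0 := by
    rintro rfl
    have hFP : F = P := by
      rw [hl]
      simp
    have htop : affineSpan ℝ P = ⊤ := by
      have h1 : affineSpan ℝ (interior P) = ⊤ :=
        isOpen_interior.affineSpan_eq_top ⟨o, mem_interior_iff_mem_nhds.2 (hnhds o ho)⟩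
      exact top_le_iff.1 (h1 ▸ affineSpan_mono ℝ interior_subset)
    rw [hFP, ← direction_affineSpan, htop, AffineSubspace.direction_top, finrank_top,
      Module.finrank_fin_fun] at hrank
    omega
  obtain ⟨a, ha, c, hc, hac⟩ : ∃ a ∈ F, ∃ c ∈ F, a ≠ c := by
    by_contra! h
    rw [vectorSpan_of_subsingleton ℝ (fun a ha c hc => h a ha c hc), finrank_bot] at hrank
    omega
  have haF := ha
  have hcF := hc
  rw [hl] at ha hc
  have hlac : l a = l c := le_antisymm (hc.2 a ha.1) (ha.2 c hc.1)
  have hPi : ∀ x ∈ P, ∀ i, u i ⬝ᵥ x ≤ b i := fun x hx => by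
    rw [hP] at hx
    exact hx
  -- If all inequalities were strict at the midpoint of `a` and `c`, the nonzero functional `l`
  -- would have a local maximum at an interior point. An inequality tight at the midpoint is tight
  -- at both ends.
  obtain ⟨i, hi⟩ : ∃ i, b i ≤ u i ⬝ᵥ ((1 / 2 : ℝ) • (a + c)) := by
    by_contra! h
    have hmax : IsLocalMax l ((1 / 2 : ℝ) • (a + c)) := by
      filter_upwards [hnhds _ h] with y hy
      rw [map_smul, map_add, ← hlac, smul_eq_mul]
      linarith [ha.2 y hy]
    have := hmax.fderiv_eq_zero
    rw [l.fderiv] at this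
    exact hl0 this
  refine ⟨i, ?_⟩
  rw [dotProduct_smul, dotProduct_add, smul_eq_mul] at hi
  have hia : u i ⬝ᵥ a = b i := by linarith [hPi a ha.1 i, hPi c hc.1 i]
  have hic : u i ⬝ᵥ c = b i := by linarith [hPi a ha.1 i, hPi c hc.1 i]
  have hoP : o ∈ P := mem_of_mem_nhds (hnhds o ho)
  have huo := ho i
  -- Both `l` and `u i` vanish on `a - c ≠ 0`, so in the plane they are proportional.
  have hpar : l ![1, 0] * u i 1 = l ![0, 1] * u i 0 := by
    have h1 : l ![1, 0] * (a 0 - c 0) + l ![0, 1] * (a 1 - c 1) = 0 := by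
      have := hlac
      rw [strongDual_apply l a, strongDual_apply l c] at this
      linear_combination this
    have h2 : u i 0 * (a 0 - c 0) + u i 1 * (a 1 - c 1) = 0 := by
      have := hia.trans hic.symm
      simp only [dotProduct, Fin.sum_univ_two] at this
      linear_combination this
    have h3 : (l ![1, 0] * u i 1 - l ![0, 1] * u i 0) * (a 0 - c 0) = 0 := by
      linear_combination u i 1 * h1 - l ![0, 1] * h2
    have h4 : (l ![1, 0] * u i 1 - l ![0, 1] * u i 0) * (a 1 - c 1) = 0 := by
      linear_combination l ![1, 0] * h2 - u i 0 * h1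
    by_contra h
    have h5 := (mul_eq_zero.1 h3).resolve_left (sub_ne_zero.2 h)
    have h6 := (mul_eq_zero.1 h4).resolve_left (sub_ne_zero.2 h)
    refine hac (funext fun j => ?_)
    fin_cases j
    · exact sub_eq_zero.1 h5
    · exact sub_eq_zero.1 h6
  have hscale : ∀ z, l z * (u i ⬝ᵥ u i) = l (u i) * (u i ⬝ᵥ z) := by
    intro z
    rw [strongDual_apply l z, strongDual_apply l (u i)]
    simp only [dotProduct, Fin.sum_univ_two]
    linear_combination (u i 1 * z 0 - u i 0 * z 1) * hpar
  have hD : 0 < u i ⬝ᵥ u i := by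
    refine lt_of_le_of_ne (Finset.sum_nonneg fun i _ => mul_self_nonneg _) fun h0 => ?_
    rw [eq_comm, dotProduct_self_eq_zero] at h0
    rw [h0, zero_dotProduct] at hia huo
    linarith
  -- The factor of proportionality is nonnegative because `l o ≤ l a` while `u i ⬝ᵥ o < u i ⬝ᵥ a`;
  -- it is nonzero because `l` is. Hence `l` and `u i` are maximal at the same points of `P`.
  have hT : 0 < l (u i) := by
    refine lt_of_le_of_ne ?_ fun h0 => hl0 (ContinuousLinearMap.ext fun z => ?_)
    · have h1 := ha.2 o hoP
      nlinarith [hscale a, hscale o]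
    · have h1 := hscale z
      rw [← h0, zero_mul] at h1
      exact (mul_eq_zero.1 h1).resolve_right hD.ne'
  rw [hl]
  ext x
  constructor
  · rintro ⟨hx, hxb⟩
    refine ⟨hx, fun y hy => le_of_mul_le_mul_right ?_ hD⟩
    rw [hscale, hscale, hxb]
    exact mul_le_mul_of_nonneg_left (hPi y hy i) hT.le
  · rintro ⟨hx, hm⟩
    refine ⟨hx, le_antisymm (hPi x hx i) (le_of_mul_le_mul_left ?_ hT)⟩
    rw [← hia, ← hscale, ← hscale]
    exact mul_le_mul_of_nonneg_right (hm a ha.1) hD.le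

theorem isFacet_edge {p : Fin 2 → ℝ} {v : Fin 2 → ℤ} {L : ℝ} (hv : IsCoprime (v 0) (v 1))
    (hL : 0 < L) (h : IsExposed ℝ P (edge p v L)) : IsFacet (d := 1) P (edge p v L) :=
  ⟨h, ⟨p, left_mem_segment ℝ _ _⟩, finrank_vectorSpan_edge hv hL⟩

/-- A small move from `x` along `u` violates the inequality, so no neighbourhood of `x` lies in `P`.
-/
theorem mem_frontier_of_dotProduct_eq {u : Fin 2 → ℝ} {b : ℝ} (hu : u ≠ 0)
    (h : ∀ x ∈ P, u ⬝ᵥ x ≤ b) {x : Fin 2 → ℝ} (hx : x ∈ P) (hxb : u ⬝ᵥ x = b) :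
    x ∈ frontier P := by
  refine ⟨subset_closure hx, fun hi => ?_⟩
  have hc : Filter.Tendsto (fun t : ℝ => x + t • u) (nhds 0) (nhds x) := by
    have : Continuous fun t : ℝ => x + t • u := by fun_prop
    simpa using this.tendsto 0
  have h1 := hc.eventually (mem_interior_iff_mem_nhds.1 hi)
  obtain ⟨ε, hε, hball⟩ := Metric.eventually_nhds_iff.1 h1
  have h2 := h _ (hball (y := ε / 2) (by simp [abs_of_pos hε]; linarith))
  rw [dotProduct_add, dotProduct_smul, hxb, smul_eq_mul] at h2
  have h3 : 0 < u ⬝ᵥ u := by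
    refine lt_of_le_of_ne (Finset.sum_nonneg fun i _ => mul_self_nonneg _) fun h0 => hu ?_
    exact dotProduct_self_eq_zero.1 h0.symm
  nlinarith

end Polygon

/-! ### Boundary measure of an irredundantly described polygon -/

section Polygon

variable {k : ℕ} {P : Set (Fin 2 → ℝ)} {u : Fin k → Fin 2 → ℝ} {b : Fin k → ℝ}

/-- A polygon in `ℝ²`, described by irredundant inequalities `⟨u i, x⟩ ≤ b i` and by the edges on
which these are equalities. -/
structure IsLatticePolygon (P : Set (Fin 2 → ℝ)) (u : Fin k → Fin 2 → ℝ) (b : Fin k → ℝ)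
    (p : Fin k → Fin 2 → ℝ) (v : Fin k → Fin 2 → ℤ) (L : Fin k → ℝ) : Prop where
  mem_iff : ∀ x, x ∈ P ↔ ∀ i, u i ⬝ᵥ x ≤ b i
  pos : ∀ i, 0 < b i
  coprime : ∀ i, IsCoprime (v i 0) (v i 1)
  length_pos : ∀ i, 0 < L i
  setOf_eq : ∀ i, {x ∈ P | u i ⬝ᵥ x = b i} = edge (p i) (v i) (L i)
  lt : ∀ i j, i ≠ j → ∀ t, 0 < t → t < L i → u j ⬝ᵥ (p i + t • toReal (v i)) < b j

namespace IsLatticePolygon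

variable {p : Fin k → Fin 2 → ℝ} {v : Fin k → Fin 2 → ℤ} {L : Fin k → ℝ}
  (h : IsLatticePolygon P u b p v L)

include h

/-- This is where irredundancy is used: on an open edge every other inequality is strict. It keeps
the edges distinct and prevents double counting of mass. -/
theorem disjoint {i j : Fin k} (hij : i ≠ j) :
    Disjoint (edge (p j) (v j) (L j)) (intrinsicInterior ℝ (edge (p i) (v i) (L i))) := by
  rw [Set.disjoint_left]
  intro x hx hxi
  obtain ⟨t, h0, h1, rfl⟩ := (mem_intrinsicInterior_edge (h.coprime i) (h.length_pos i)).1 hxi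
  rw [← h.setOf_eq] at hx
  exact (h.lt i j hij t h0 h1).ne hx.2

theorem injective : Function.Injective fun i => edge (p i) (v i) (L i) := by
  intro i j hij
  by_contra hne
  have h1 := h.disjoint hne
  have hL := h.length_pos i
  have h2 : p i + (L i / 2) • toReal (v i) ∈ intrinsicInterior ℝ (edge (p i) (v i) (L i)) :=
    (mem_intrinsicInterior_edge (h.coprime i) hL).2 ⟨L i / 2, by linarith, by linarith, rfl⟩
  rw [← show edge (p i) (v i) (L i) = edge (p j) (v j) (L j) from hij] at h1
  exact Set.disjoint_left.1 h1 (intrinsicInterior_subset h2) h2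

theorem isExposed_edge (i : Fin k) : IsExposed ℝ P (edge (p i) (v i) (L i)) := by
  rw [← h.setOf_eq]
  exact isExposed_setOf_dotProduct_eq fun x hx => (h.mem_iff x).1 hx i

theorem isFacet_iff (G : Set (Fin 2 → ℝ)) :
    IsFacet (d := 1) P G ↔ ∃ i, edge (p i) (v i) (L i) = G := by
  constructor
  · intro hG
    obtain ⟨i, hi⟩ := hG.exists_eq (Set.ext h.mem_iff) (o := 0)
      (fun i => by rw [dotProduct_zero]; exact h.pos i)
    exact ⟨i, by rw [← hi, h.setOf_eq]⟩
  · rintro ⟨i, rfl⟩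
    exact isFacet_edge (h.coprime i) (h.length_pos i) (h.isExposed_edge i)

theorem isClosed : IsClosed P := by
  have hP : P = {x | ∀ i, u i ⬝ᵥ x ≤ b i} := Set.ext h.mem_iff
  rw [hP, Set.ofPred_forall]
  refine isClosed_iInter fun i => isClosed_le ?_ continuous_const
  show Continuous fun y : Fin 2 → ℝ => ∑ j, u i j * y j
  fun_prop

theorem measurableSet_edge (i : Fin k) : MeasurableSet (edge (p i) (v i) (L i)) := by
  have h1 : IsClosed {x | u i ⬝ᵥ x = b i} := by
    refine isClosed_eq ?_ continuous_const
    show Continuous fun y : Fin 2 → ℝ => ∑ j, u i j * y j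
    fun_prop
  rw [← h.setOf_eq]
  exact (h.isClosed.inter h1).measurableSet

theorem boundaryMeasure_frontier :
    boundaryMeasure (d := 1) P (frontier P) = ∑ i, ENNReal.ofReal (L i) := by
  rw [boundaryMeasure_apply h.injective h.isFacet_iff isClosed_frontier.measurableSet]
  refine Finset.sum_congr rfl fun i _ => facetMeasure_edge_of_subset (h.coprime i) (h.length_pos i)
    isClosed_frontier.measurableSet fun x hx => ?_
  have hx' := intrinsicInterior_subset hx
  rw [← h.setOf_eq] at hx'
  refine mem_frontier_of_dotProduct_eq (u := u i) (fun h0 => ?_)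
    (fun y hy => (h.mem_iff y).1 hy i) hx'.1 hx'.2
  have h1 := hx'.2
  rw [h0, zero_dotProduct] at h1
  exact (h.pos i).ne h1

theorem boundaryMeasure_of_subset_edge (j : Fin k) {S : Set (Fin 2 → ℝ)} (hS : MeasurableSet S)
    (h1 : intrinsicInterior ℝ (edge (p j) (v j) (L j)) ⊆ S) (h2 : S ⊆ edge (p j) (v j) (L j)) :
    boundaryMeasure (d := 1) P S = ENNReal.ofReal (L j) := by
  rw [boundaryMeasure_apply h.injective h.isFacet_iff hS, Finset.sum_eq_single j]
  · exact facetMeasure_edge_of_subset (h.coprime j) (h.length_pos j) hS h1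
  · exact fun i _ hij => facetMeasure_of_disjoint (d := 1) hS ((h.disjoint hij).mono_left h2)
  · exact fun hj => absurd (Finset.mem_univ j) hj

theorem normalizedBoundaryMeasure_edge (j : Fin k) :
    normalizedBoundaryMeasure (d := 1) P (edge (p j) (v j) (L j)) =
      (∑ i, ENNReal.ofReal (L i))⁻¹ * ENNReal.ofReal (L j) := by
  rw [normalizedBoundaryMeasure, Measure.smul_apply, h.boundaryMeasure_frontier,
    h.boundaryMeasure_of_subset_edge j (h.measurableSet_edge j) intrinsicInterior_subset
      subset_rfl, smul_eq_mul]

end IsLatticePolygon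

end Polygon

/-! ### The moment triangle and its dual pentagon -/

theorem mem_momentP2 (x : Fin 2 → ℝ) :
    x ∈ momentP2 ↔ -1 ≤ x 0 ∧ -1 ≤ x 1 ∧ x 0 + x 1 ≤ 1 := by
  constructor
  · have hconv : Convex ℝ {x : Fin 2 → ℝ | -1 ≤ x 0 ∧ -1 ≤ x 1 ∧ x 0 + x 1 ≤ 1} := by
      rintro x ⟨hx1, hx2, hx3⟩ y ⟨hy1, hy2, hy3⟩ a b ha hb hab
      simp only [Set.mem_ofPred_eq, Pi.add_apply, Pi.smul_apply, smul_eq_mul]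
      refine ⟨?_, ?_, ?_⟩ <;> nlinarith
    intro hx
    refine convexHull_min ?_ hconv hx
    rintro y (rfl | rfl | rfl) <;> norm_num [toReal]
  · rintro ⟨h1, h2, h3⟩
    -- The weights are barycentric coordinates: each is the slack of `x` at the side opposite the
    -- vertex, divided by 3.
    have := (convex_convexHull ℝ ({toReal ![-1, 2], toReal ![2, -1], toReal ![-1, -1]} :
      Set (Fin 2 → ℝ))).sum_mem (t := Finset.univ)
      (w := ![(x 1 + 1) / 3, (x 0 + 1) / 3, (1 - x 0 - x 1) / 3])
      (z := ![toReal ![-1, 2], toReal ![2, -1], toReal ![-1, -1]]) ?_ ?_ ?_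
    · rw [momentP2]
      convert this using 1
      funext i
      fin_cases i <;> simp [Fin.sum_univ_three, toReal] <;> ring
    · intro i _
      fin_cases i <;> simp <;> linarith
    · simp [Fin.sum_univ_three]
      ring
    · intro i _
      refine subset_convexHull ℝ _ ?_
      fin_cases i <;> simp

theorem mem_latticePoints_momentP2 (m : Fin 2 → ℤ) :
    m ∈ latticePoints momentP2 ↔ -1 ≤ m 0 ∧ -1 ≤ m 1 ∧ m 0 + m 1 ≤ 1 := by
  show toReal m ∈ momentP2 ↔ _
  rw [mem_momentP2]
  simp only [toReal]
  norm_cast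

theorem isLatticePolygon_momentP2 :
    IsLatticePolygon momentP2 ![![-1, 0], ![0, -1], ![1, 1]] ![1, 1, 1]
      ![![-1, -1], ![-1, -1], ![-1, 2]] ![![0, 1], ![1, 0], ![1, -1]] ![3, 3, 3] where
  mem_iff x := by
    rw [mem_momentP2]
    constructor
    · rintro ⟨h1, h2, h3⟩ i
      fin_cases i <;> simp [dotProduct] <;> linarith
    · intro h
      have h1 := h 0
      have h2 := h 1
      have h3 := h 2
      simp [dotProduct] at h1 h2 h3
      refine ⟨?_, ?_, ?_⟩ <;> linarith
  pos i := by fin_cases i <;> simp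
  coprime i := by
    fin_cases i <;> first | exact isCoprime_one_left | exact isCoprime_one_right
  length_pos i := by fin_cases i <;> simp
  setOf_eq i := by
    ext x
    rw [mem_edge (by fin_cases i <;> simp), Set.mem_ofPred_eq, mem_momentP2]
    constructor
    · rintro ⟨⟨h1, h2, h3⟩, h4⟩
      refine ⟨![x 1 + 1, x 0 + 1, x 0 + 1] i, ?_, ?_, ?_⟩
      · fin_cases i <;> simp [dotProduct] at h4 ⊢ <;> linarith
      · fin_cases i <;> simp [dotProduct] at h4 ⊢ <;> linarith
      · funext j
        fin_cases i <;> fin_cases j <;> simp [dotProduct, toReal] at h4 ⊢ <;> linarith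
    · rintro ⟨t, h0, h1, rfl⟩
      refine ⟨⟨?_, ?_, ?_⟩, ?_⟩ <;> fin_cases i <;> simp [dotProduct, toReal] at h1 ⊢ <;> linarith
  lt i j hij t h0 h1 := by
    fin_cases i <;> fin_cases j <;> simp [dotProduct, toReal] at h1 hij ⊢ <;> linarith

/-- Of the ten lattice points of Δ only five give facets. The inequalities of the other five follow:
for instance (-1,1) is the mean of (-1,0) and (-1,2), and 5 is the mean of their heights 1 and 9. -/
theorem mem_dualPolytope_heightP2 (x : Fin 2 → ℝ) :
    x ∈ dualPolytope momentP2 heightP2 ↔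
      -1 ≤ x 0 ∧ -x 0 + 2 * x 1 ≤ 9 ∧ x 0 ≤ 1 ∧ 2 * x 0 - x 1 ≤ 1 ∧ -x 0 - x 1 ≤ 1 := by
  constructor
  · intro h
    have key : ∀ a b : ℤ, -1 ≤ a → -1 ≤ b → a + b ≤ 1 →
        (a * x 0 + b * x 1 : ℝ) ≤ (heightP2 ![a, b] : ℝ) := fun a b h1 h2 h3 => by
      have := h ![a, b] ((mem_latticePoints_momentP2 _).2 ⟨h1, h2, h3⟩)
      simpa [dotProduct, toReal] using this
    have e1 : heightP2 ![-1, 0] = 1 := by decide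
    have e2 : heightP2 ![-1, 2] = 9 := by decide
    have e3 : heightP2 ![1, 0] = 1 := by decide
    have e4 : heightP2 ![2, -1] = 1 := by decide
    have e5 : heightP2 ![-1, -1] = 1 := by decide
    have h1 := key (-1) 0 (by norm_num) (by norm_num) (by norm_num)
    have h2 := key (-1) 2 (by norm_num) (by norm_num) (by norm_num)
    have h3 := key 1 0 (by norm_num) (by norm_num) (by norm_num)
    have h4 := key 2 (-1) (by norm_num) (by norm_num) (by norm_num)
    have h5 := key (-1) (-1) (by norm_num) (by norm_num) (by norm_num)
    rw [e1] at h1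
    rw [e2] at h2
    rw [e3] at h3
    rw [e4] at h4
    rw [e5] at h5
    push_cast at h1 h2 h3 h4 h5
    refine ⟨?_, ?_, ?_, ?_, ?_⟩ <;> linarith
  · rintro ⟨h1, h2, h3, h4, h5⟩ m hm
    obtain ⟨hm1, hm2, hm3⟩ := (mem_latticePoints_momentP2 m).1 hm
    have hdot : toReal m ⬝ᵥ x = m 0 * x 0 + m 1 * x 1 := by
      simp [dotProduct, toReal]
    have hmeta : m = ![m 0, m 1] := by
      funext i
      fin_cases i <;> rfl
    rw [hdot, hmeta]
    generalize m 0 = a at *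
    generalize m 1 = b at *
    have ha : a ≤ 2 := by linarith
    have hb : b ≤ 2 := by linarith
    interval_cases a <;> interval_cases b <;> first
      | (exfalso; omega)
      | (rw [show heightP2 ![-1, -1] = 1 by decide]; push_cast; linarith)
      | (rw [show heightP2 ![-1, 0] = 1 by decide]; push_cast; linarith)
      | (rw [show heightP2 ![-1, 1] = 5 by decide]; push_cast; linarith)
      | (rw [show heightP2 ![-1, 2] = 9 by decide]; push_cast; linarith)
      | (rw [show heightP2 ![0, -1] = 1 by decide]; push_cast; linarith)
      | (rw [show heightP2 ![0, 0] = 0 by decide]; push_cast; linarith)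
      | (rw [show heightP2 ![0, 1] = 5 by decide]; push_cast; linarith)
      | (rw [show heightP2 ![1, -1] = 1 by decide]; push_cast; linarith)
      | (rw [show heightP2 ![1, 0] = 1 by decide]; push_cast; linarith)
      | (rw [show heightP2 ![2, -1] = 1 by decide]; push_cast; linarith)

theorem isLatticePolygon_dualPolytope :
    IsLatticePolygon (dualPolytope momentP2 heightP2)
      ![![-1, 0], ![-1, 2], ![1, 0], ![2, -1], ![-1, -1]] ![1, 9, 1, 1, 1]
      ![![-1, 0], ![-1, 4], ![1, 1], ![0, -1], ![-1, 0]]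
      ![![0, 1], ![2, 1], ![0, 1], ![1, 2], ![1, -1]] ![4, 1, 4, 1, 1] where
  mem_iff x := by
    rw [mem_dualPolytope_heightP2]
    constructor
    · rintro ⟨h1, h2, h3, h4, h5⟩ i
      fin_cases i <;> simp [dotProduct] <;> linarith
    · intro h
      have h1 := h 0
      have h2 := h 1
      have h3 := h 2
      have h4 := h 3
      have h5 := h 4
      simp [dotProduct] at h1 h2 h3 h4 h5
      refine ⟨?_, ?_, ?_, ?_, ?_⟩ <;> linarith
  pos i := by fin_cases i <;> simp
  coprime i := by
    fin_cases i <;> first | exact isCoprime_one_left | exact isCoprime_one_right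
  length_pos i := by fin_cases i <;> simp
  setOf_eq i := by
    ext x
    rw [mem_edge (by fin_cases i <;> simp), Set.mem_ofPred_eq, mem_dualPolytope_heightP2]
    constructor
    · rintro ⟨⟨h1, h2, h3, h4, h5⟩, h6⟩
      -- On each edge the parameter is read off from a coordinate in which the direction vector has
      -- entry 1.
      refine ⟨![x 1, x 1 - 4, x 1 - 1, x 0, x 0 + 1] i, ?_, ?_, ?_⟩
      · fin_cases i <;> simp [dotProduct] at h6 ⊢ <;> linarith
      · fin_cases i <;> simp [dotProduct] at h6 ⊢ <;> linarith
      · funext j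
        fin_cases i <;> fin_cases j <;> simp [dotProduct, toReal] at h6 ⊢ <;> linarith
    · rintro ⟨t, h0, h1, rfl⟩
      refine ⟨⟨?_, ?_, ?_, ?_, ?_⟩, ?_⟩ <;> fin_cases i <;>
        simp [dotProduct, toReal] at h1 ⊢ <;> linarith
  lt i j hij t h0 h1 := by
    fin_cases i <;> fin_cases j <;> simp [dotProduct, toReal] at h1 hij ⊢ <;> linarith

theorem dualFace_eq_edge :
    dualFace momentP2 heightP2 ![-1, 0] = edge ![-1, 0] ![0, 1] 4 := by
  have h := isLatticePolygon_dualPolytope.setOf_eq 0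
  have hh : heightP2 ![-1, 0] = 1 := by decide
  have hr : toReal ![-1, 0] = ![(-1 : ℝ), 0] := by
    funext i
    fin_cases i <;> simp [toReal]
  rw [show edge ![-1, 0] ![0, 1] 4 = _ from h.symm]
  ext x
  show _ ∧ _ ↔ _ ∧ _
  rw [hh, hr]
  simp

/-- The point (-1,0) is interior to the left edge. A functional maximal there is constant along that
edge, by comparison with its two ends; comparison with (2,-1) then shows that it exposes either the
left edge or all of Δ. -/
theorem closedStar_momentP2 :
    closedStar momentP2 (toReal ![-1, 0]) = edge ![-1, -1] ![0, 1] 3 := by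
  have hedge : ∀ x, x ∈ edge ![-1, -1] ![0, 1] 3 ↔ x ∈ momentP2 ∧ x 0 = -1 := fun x => by
    rw [show edge ![-1, -1] ![0, 1] 3 = _ from (isLatticePolygon_momentP2.setOf_eq 0).symm]
    refine and_congr_right fun _ => ?_
    simp [dotProduct, neg_eq_iff_eq_neg]
  refine Set.Subset.antisymm ?_ ?_
  · rintro x ⟨F, ⟨hexp, hne, hm⟩, hx⟩
    obtain ⟨l, hl⟩ := hexp ⟨_, hm⟩
    rw [hl] at hm hx
    have h1 := hm.2 ![-1, 2] (by rw [mem_momentP2]; norm_num)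
    have h2 := hm.2 ![-1, -1] (by rw [mem_momentP2]; norm_num)
    have h3 := hm.2 ![2, -1] (by rw [mem_momentP2]; norm_num)
    have h4 := hx.2 _ hm.1
    rw [strongDual_apply l (toReal _)] at h1 h2 h3 h4
    rw [strongDual_apply l] at h1 h2 h3 h4
    simp [toReal] at h1 h2 h3 h4
    have hl1 : l ![0, 1] = 0 := by linarith
    rw [strongDual_apply l x, hl1] at h4
    rw [hedge]
    refine ⟨hx.1, le_antisymm ?_ ((mem_momentP2 x).1 hx.1).1⟩
    rcases eq_or_ne (l ![1, 0]) 0 with h0 | h0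
    · refine absurd ?_ hne
      have hl0 : ∀ y, l y = 0 := fun y => by
        rw [strongDual_apply, h0, hl1]
        ring
      rw [hl]
      simp [hl0]
    · have hneg : l ![1, 0] < 0 := lt_of_le_of_ne (by linarith) h0
      nlinarith
  · intro x hx
    refine ⟨edge ![-1, -1] ![0, 1] 3, ⟨isLatticePolygon_momentP2.isExposed_edge 0, ?_, ?_⟩, hx⟩
    · intro heq
      have h1 : (![2, -1] : Fin 2 → ℝ) ∈ edge ![-1, -1] ![0, 1] 3 := by
        rw [heq, mem_momentP2]
        norm_num
      rw [hedge] at h1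
      have := h1.2
      norm_num at this
    · rw [hedge, mem_momentP2]
      norm_num [toReal]

/-! ### The two mass ratios -/

theorem normalizedBoundaryMeasure_dualFace :
    normalizedBoundaryMeasure (d := 1) (dualPolytope momentP2 heightP2)
      (dualFace momentP2 heightP2 ![-1, 0]) = (4 / 11 : ENNReal) := by
  have h := isLatticePolygon_dualPolytope.normalizedBoundaryMeasure_edge 0
  rw [dualFace_eq_edge]
  refine h.trans ?_
  simp [Fin.sum_univ_succ]
  rw [mul_comm, div_eq_mul_inv]
  norm_num

theorem normalizedBoundaryMeasure_closedStar :
    normalizedBoundaryMeasure (d := 1) momentP2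
      (closedStar momentP2 (toReal ![-1, 0])) = (1 / 3 : ENNReal) := by
  have h := isLatticePolygon_momentP2.normalizedBoundaryMeasure_edge 0
  rw [closedStar_momentP2]
  refine h.trans ?_
  simp [Fin.sum_univ_succ]
  rw [show (3 + (3 + 3) : ENNReal) = 3 * 3 by norm_num,
    ENNReal.mul_inv (by simp) (by simp), mul_assoc, ENNReal.inv_mul_cancel (by simp) (by simp),
    mul_one]

/-! ### Prescribed and available Monge–Ampère mass on the facet dual to (-1,0) -/

theorem canonicalTarget_interior {E : Set (Fin 2 → ℝ)} (hE : MeasurableSet E)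
    (h : E = intrinsicInterior ℝ (edge ![-1, 0] ![0, 1] 4)) :
    canonicalTarget (d := 1) momentP2 heightP2 E = (36 / 11 : ENNReal) := by
  rw [canonicalTarget, Measure.smul_apply, isLatticePolygon_dualPolytope.boundaryMeasure_frontier,
    isLatticePolygon_momentP2.boundaryMeasure_frontier,
    isLatticePolygon_dualPolytope.boundaryMeasure_of_subset_edge 0 hE h.ge
      (h.le.trans intrinsicInterior_subset)]
  simp [Fin.sum_univ_succ]
  rw [div_eq_mul_inv, div_eq_mul_inv, mul_right_comm]
  norm_num

/-- A subgradient on an open interval of the restriction of a convex function to a line is a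
subgradient on the whole line. -/
theorem subgradient_global {f : ℝ → ℝ} (hf : ConvexOn ℝ Set.univ f) {a b y p : ℝ}
    (hay : a < y) (hyb : y < b) (h : ∀ z, a < z → z < b → f y + p * (z - y) ≤ f z) (z : ℝ) :
    f y + p * (z - y) ≤ f z := by
  have hc : Filter.Tendsto (fun s : ℝ => y + s * (z - y)) (nhdsWithin 0 (Set.Ioi 0)) (nhds y) := by
    have : Continuous fun s : ℝ => y + s * (z - y) := by fun_prop
    refine tendsto_nhdsWithin_of_tendsto_nhds ?_
    simpa using this.tendsto 0
  -- For small `s > 0` the point `y + s * (z - y)` lies in the interval, where the subgradient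
  -- inequality holds. Convexity bounds `f` there by the chord from `y` to `z`; dividing by `s`
  -- gives the inequality at `z`.
  obtain ⟨s, hs, hs01⟩ := ((hc.eventually (Ioo_mem_nhds hay hyb)).and
    (Ioo_mem_nhdsGT (zero_lt_one' ℝ))).exists
  have h1 := h _ hs.1 hs.2
  have h2 := hf.2 (Set.mem_univ y) (Set.mem_univ z) (sub_nonneg.2 hs01.2.le) hs01.1.le
    (sub_add_cancel 1 s)
  simp only [smul_eq_mul] at h2
  rw [show (1 - s) * y + s * z = y + s * (z - y) by ring] at h2
  have h3 : s * (f y + p * (z - y)) ≤ s * f z := by nlinarith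
  exact le_of_mul_le_mul_left h3 hs01.1

theorem le_of_forall_mul_le {p q K : ℝ} (h : ∀ T, 0 ≤ T → p * T ≤ q * T + K) : p ≤ q := by
  by_contra! hlt
  have h0 := h 0 le_rfl
  -- At this `T` the gap `(p - q) * T` is `K + 1`, exceeding `K`. The case `T = 0` gives `K ≥ 0`,
  -- hence `T ≥ 0`.
  have h1 := h ((K + 1) / (p - q)) (div_nonneg (by linarith) (by linarith))
  have h2 : (p - q) * ((K + 1) / (p - q)) = K + 1 := mul_div_cancel₀ _ (by linarith)
  linarith

/-- Along x₀ = -1 the model function has asymptotic slopes -1 and 2, the extreme values of `m 1` on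
Δ. A bounded perturbation cannot change them, and a global affine minorant cannot be steeper. -/
theorem IsPotential.subgradient_mem_Icc {Ψ : (Fin 2 → ℝ) → ℝ} (hΨ : IsPotential momentP2 Ψ)
    {y p : ℝ} (h0 : 0 < y) (h4 : y < 4)
    (h : ∀ z, 0 < z → z < 4 → Ψ ![-1, y] + p * (z - y) ≤ Ψ ![-1, z]) : p ∈ Set.Icc (-1) 2 := by
  obtain ⟨hconv, C, hC⟩ := hΨ
  have hline : ConvexOn ℝ Set.univ fun t : ℝ => Ψ ![-1, t] := by
    refine ⟨convex_univ, fun s _ t _ a b ha hb hab => ?_⟩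
    have := hconv.2 (Set.mem_univ ![-1, s]) (Set.mem_univ ![-1, t]) ha hb hab
    convert this using 2
    funext i
    fin_cases i <;> simp
    linarith
  have hglob := subgradient_global hline h0 h4 h
  have hne : Nonempty (latticePoints momentP2) :=
    ⟨0, (mem_latticePoints_momentP2 0).2 (by simp)⟩
  have hgrowth : ∀ z B : ℝ, (∀ m ∈ latticePoints momentP2, -(m 0 : ℝ) + m 1 * z ≤ B) →
      Ψ ![-1, z] ≤ B + C := fun z B hB => by
    have h1 := (abs_le.1 (hC ![-1, z])).2
    have h2 : (⨆ m : latticePoints momentP2, toReal m.1 ⬝ᵥ ![-1, z]) ≤ B :=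
      ciSup_le fun m => by
        have := hB m.1 m.2
        simpa [dotProduct, toReal] using this
    linarith
  constructor
  · have : -p ≤ 1 := by
      -- The terms of `K` come from `-m 0 ≤ 1`, `m 1 * y ≤ 2 * y` (as `y > 0`), the error `C` and
      -- the value at `y`; the coefficient of `T` is `-m 1 ≤ 1`.
      refine le_of_forall_mul_le (K := 1 + C - Ψ ![-1, y] + 2 * y) fun T hT => ?_
      have h1 := hglob (y - T)
      have h2 := hgrowth (y - T) (1 + 2 * y + T) fun m hm => by
        obtain ⟨hm0, hm1, hm2⟩ := (mem_latticePoints_momentP2 m).1 hm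
        have hm0' : (-1 : ℝ) ≤ m 0 := by exact_mod_cast hm0
        have hm1' : (-1 : ℝ) ≤ m 1 := by exact_mod_cast hm1
        have hm1'' : (m 1 : ℝ) ≤ 2 := by exact_mod_cast (by linarith : m 1 ≤ 2)
        nlinarith
      linarith
    linarith
  · refine le_of_forall_mul_le (K := 1 + C - Ψ ![-1, y] + 2 * y) fun T hT => ?_
    have h1 := hglob (y + T)
    have h2 := hgrowth (y + T) (1 + 2 * (y + T)) fun m hm => by
      obtain ⟨hm0, hm1, hm2⟩ := (mem_latticePoints_momentP2 m).1 hm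
      have hm0' : (-1 : ℝ) ≤ m 0 := by exact_mod_cast hm0
      have hm1' : (m 1 : ℝ) ≤ 2 := by exact_mod_cast (by linarith : m 1 ≤ 2)
      nlinarith
    linarith

theorem not_solvesMongeAmpere {Ψ : (Fin 2 → ℝ) → ℝ} (hΨ : IsPotential momentP2 Ψ) :
    ¬ SolvesMongeAmpere (d := 1) (dualPolytope momentP2 heightP2) Ψ
      (canonicalTarget (d := 1) momentP2 heightP2) := by
  intro hsol
  have hcop : IsCoprime ((![0, 1] : Fin 2 → ℤ) 0) ((![0, 1] : Fin 2 → ℤ) 1) := isCoprime_one_right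
  have hL : (0 : ℝ) < 4 := by norm_num
  have hint : intrinsicInterior ℝ (edge ![-1, 0] ![0, 1] 4) =
      {x : Fin 2 → ℝ | x 0 = -1 ∧ 0 < x 1 ∧ x 1 < 4} := by
    ext x
    rw [mem_intrinsicInterior_edge hcop hL]
    constructor
    · rintro ⟨t, h0, h1, rfl⟩
      refine ⟨?_, ?_, ?_⟩ <;> simp [toReal, h0, h1]
    · rintro ⟨hx, h0, h1⟩
      refine ⟨x 1, h0, h1, ?_⟩
      funext i
      fin_cases i <;> simp [toReal, hx]
  have hmeas : MeasurableSet (intrinsicInterior ℝ (edge ![-1, 0] ![0, 1] 4)) := by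
    rw [hint]
    exact ((measurable_pi_apply 0) (measurableSet_singleton _)).inter
      (((measurable_pi_apply 1) measurableSet_Ioi).inter
        ((measurable_pi_apply 1) measurableSet_Iio))
  have hfacet : IsFacet (d := 1) (dualPolytope momentP2 heightP2) (edge ![-1, 0] ![0, 1] 4) :=
    (isLatticePolygon_dualPolytope.isFacet_iff _).2 ⟨0, rfl⟩
  -- Testing the equation on one set, the whole open facet, already gives the contradiction.
  have h := hsol _ hfacet (edgeChart ![-1, 0] hcop hL) _ subset_rfl hmeas
  rw [canonicalTarget_interior hmeas rfl] at h
  have hparam : ∀ y : Fin 1 → ℝ, (edgeChart ![-1, 0] hcop hL).param y = ![-1, y 0] := fun y => by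
    rw [LatticeChart.param_one]
    funext i
    fin_cases i <;> simp [edgeChart, toReal]
  have hmem : ∀ y : Fin 1 → ℝ, (edgeChart ![-1, 0] hcop hL).param y ∈
      intrinsicInterior ℝ (edge ![-1, 0] ![0, 1] 4) ↔ 0 < y 0 ∧ y 0 < 4 := fun y => by
    rw [hparam, hint]
    simp
  have hsub : mongeAmpere (edgeChart ![-1, 0] hcop hL) Ψ
      (intrinsicInterior ℝ (edge ![-1, 0] ![0, 1] 4)) ≤ 3 := by
    -- All subgradients over the facet lie in [-1, 2], of length 3, whereas the equation demands
    -- 36/11 > 33/11.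
    have hvol : volume (Set.pi Set.univ fun _ : Fin 1 => Set.Icc (-1 : ℝ) 2) = 3 := by
      rw [volume_pi_pi]
      norm_num
    rw [← hvol]
    refine measure_mono (Set.iUnion₂_subset fun y hy p hp i _ => ?_)
    obtain ⟨h0, h4⟩ := (hmem y).1 hy
    rw [Subsingleton.elim i 0]
    refine hΨ.subgradient_mem_Icc h0 h4 fun z hz0 hz4 => ?_
    have := hp (fun _ => z) ((hmem _).2 ⟨hz0, hz4⟩)
    simpa [hparam, dotProduct] using this
  rw [h] at hsub
  have : (36 / 11 : ENNReal) ≤ 3 ↔ (36 : ENNReal) ≤ 3 * 11 :=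
    ENNReal.div_le_iff (by simp) (by simp)
  rw [this] at hsub
  norm_num at hsub

end TropicalMA

theorem mainTheorem10 :
    TropicalMA.normalizedBoundaryMeasure
        (TropicalMA.dualPolytope TropicalMA.momentP2 TropicalMA.heightP2)
        (TropicalMA.dualFace TropicalMA.momentP2 TropicalMA.heightP2 ![-1, 0]) =
      (4 / 11 : ENNReal) ∧
    TropicalMA.normalizedBoundaryMeasure TropicalMA.momentP2
        (TropicalMA.closedStar TropicalMA.momentP2 (TropicalMA.toReal ![-1, 0])) =
      (1 / 3 : ENNReal) ∧
    TropicalMA.normalizedBoundaryMeasure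
        (TropicalMA.dualPolytope TropicalMA.momentP2 TropicalMA.heightP2)
        (TropicalMA.dualFace TropicalMA.momentP2 TropicalMA.heightP2 ![-1, 0]) >
      TropicalMA.normalizedBoundaryMeasure TropicalMA.momentP2
        (TropicalMA.closedStar TropicalMA.momentP2 (TropicalMA.toReal ![-1, 0])) ∧
    ¬ ∃ Ψ : (Fin 2 → ℝ) → ℝ,
      TropicalMA.IsPotential TropicalMA.momentP2 Ψ ∧
      TropicalMA.SolvesMongeAmpere
        (TropicalMA.dualPolytope TropicalMA.momentP2 TropicalMA.heightP2) Ψ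
        (TropicalMA.canonicalTarget TropicalMA.momentP2 TropicalMA.heightP2) := by
  refine ⟨TropicalMA.normalizedBoundaryMeasure_dualFace,
    TropicalMA.normalizedBoundaryMeasure_closedStar, ?_,
    fun ⟨Ψ, hΨ, hsol⟩ => TropicalMA.not_solvesMongeAmpere hΨ hsol⟩
  rw [TropicalMA.normalizedBoundaryMeasure_dualFace,
    TropicalMA.normalizedBoundaryMeasure_closedStar, gt_iff_lt,
    ENNReal.lt_div_iff_mul_lt (by simp) (by simp), one_div, mul_comm, ← div_eq_mul_inv,
    ENNReal.div_lt_iff (by simp) (by simp)]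
  norm_num
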